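/- Let $L^2=L^2(\mathbb{T})$ be taken with respect to normalised Lebesgue measure on the unit circle $\mathbb{T}$, and let $H^2\subseteq L^2$ be the Hardy space, i.e. the subspace of functions whose Fourier coefficients of negative index vanish. Let $\theta$ be an inner function (that is, $\theta\in H^2$ and $|\theta|=1$ a.e. on $\mathbb{T}$), let $K_\theta=\theta\,\overline{H^2_0}\cap H^2$ with $\overline{H^2_0}=\{\overline{h}:h\in H^2,\ h(0)=0\}$ be the corresponding model space, and let $P_\theta:L^2\to K_\theta$ be the orthogonal projection. For $g\in L^2$ let $A_g^\theta$ be the truncated Toeplitz operator, i.e. the (possibly unbounded) operator in $K_\theta$ with domain $\{f\in K_\theta: gf\in L^2\}$ given by $A_g^\theta f=P_\theta(gf)$. A function $u\in H^2$ is called outer if the closed linear span of $\{z^nu:n\ge 0\}$ is $H^2$. Then for every $g\in L^2$ there exists an outer function $u\in H^2$ with $|u|=2|g|+1$ a.e. on $\mathbb{T}$; and for every such $u$ the function $\tilde g:=g-\overline{\theta u}$ belongs to $L^2$, satisfies $A_g^\theta=A_{\tilde g}^\theta$ (equality of operators, including equality of their domains), is nonzero a.e. on $\mathbb{T}$, and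 satisfies $\tilde g^{-1}\in L^\infty$. In particular, every truncated Toeplitz operator $A_g^\theta$ with $g\in L^2$ has a symbol $\tilde g\in L^2$ with $\tilde g^{-1}\in L^\infty$. -/

import Mathlib

open MeasureTheory AddCircle
open scoped ENNReal ComplexConjugate

noncomputable section

namespace HardyTTO

instance factTwoPiPos : Fact (0 < 2 * Real.pi) := ⟨Real.two_pi_pos⟩

/-- The unit circle, parametrised by `t ↦ e^{it}`, `t ∈ ℝ / 2πℤ`. The function `z ^ n` on the circle
is Mathlib's `fourier n`. -/
abbrev UnitCircle : Type := AddCircle (2 * Real.pi)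

/-- Normalised Lebesgue measure on the unit circle. -/
abbrev circleMeasure : Measure UnitCircle := haarAddCircle

/-- The Hilbert space `L²(𝕋)`. -/
abbrev L2 : Type := Lp ℂ 2 circleMeasure

lemma inner_fourierLp (n : ℤ) (f : L2) :
    inner ℂ (fourierLp 2 n : L2) f = fourierCoeff f n := by
  rw [← fourierBasis_repr, HilbertBasis.repr_apply_apply, coe_fourierBasis]

/-- The Hardy space `H²` (as boundary functions): the functions in `L²(𝕋)` all of whose Fourier
coefficients of negative index vanish. -/
def H2 : Submodule ℂ L2 where
  carrier := {f | ∀ n : ℤ, n < 0 → fourierCoeff f n = 0}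
  zero_mem' n _ := by rw [← inner_fourierLp, inner_zero_right]
  add_mem' {f g} hf hg n hn := by
    rw [← inner_fourierLp, inner_add_right, inner_fourierLp, inner_fourierLp, hf n hn, hg n hn,
      add_zero]
  smul_mem' c f hf n hn := by
    rw [← inner_fourierLp, inner_smul_right, inner_fourierLp, hf n hn, mul_zero]

/-- `θ` is an inner function: `θ ∈ H²` (equivalently, `θ ∈ H^∞`) and `|θ| = 1` a.e. on `𝕋`. -/
def IsInner (θ : L2) : Prop :=
  θ ∈ H2 ∧ ∀ᵐ t ∂circleMeasure, ‖θ t‖ = 1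

/-- `u` is an outer function of class `H²`: `u ∈ H²` and the closed linear span of the functions
`z ^ n u`, `n ≥ 0`, is the whole of `H²`. -/
def IsOuter (u : L2) : Prop :=
  u ∈ H2 ∧
    (Submodule.span ℂ {f : L2 | ∃ n : ℕ, f =ᵐ[circleMeasure]
      fun t => fourier (n : ℤ) t * u t}).topologicalClosure = H2

/-- The model space `K_θ = θ \overline{H²₀} ∩ H²`, where `H²₀ = {h ∈ H² : h(0) = 0}` and `h(0)` is
the Fourier coefficient of `h` of index `0`. -/
def modelSpace (θ : L2) : Submodule ℂ L2 where
  carrier := {f | f ∈ H2 ∧ ∃ h ∈ H2, fourierCoeff h 0 = 0 ∧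
    f =ᵐ[circleMeasure] fun t => θ t * conj (h t)}
  zero_mem' := by
    refine ⟨H2.zero_mem, 0, H2.zero_mem, ?_, ?_⟩
    · rw [← inner_fourierLp, inner_zero_right]
    · filter_upwards with t
      simp
  add_mem' := by
    rintro f₁ f₂ ⟨hf₁, h₁, hh₁, h₁0, e₁⟩ ⟨hf₂, h₂, hh₂, h₂0, e₂⟩
    refine ⟨H2.add_mem hf₁ hf₂, h₁ + h₂, H2.add_mem hh₁ hh₂, ?_, ?_⟩
    · rw [← inner_fourierLp, inner_add_right, inner_fourierLp, inner_fourierLp, h₁0, h₂0, add_zero]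
    · filter_upwards [e₁, e₂, Lp.coeFn_add f₁ f₂, Lp.coeFn_add h₁ h₂] with t a b c d
      rw [c, Pi.add_apply, a, b, d, Pi.add_apply, map_add, mul_add]
  smul_mem' := by
    rintro c f ⟨hf, h, hh, h0, e⟩
    refine ⟨H2.smul_mem c hf, conj c • h, H2.smul_mem _ hh, ?_, ?_⟩
    · rw [← inner_fourierLp, inner_smul_right, inner_fourierLp, h0, mul_zero]
    · filter_upwards [e, Lp.coeFn_smul c f, Lp.coeFn_smul (conj c) h] with t a b d
      rw [b, Pi.smul_apply, a, d, Pi.smul_apply, smul_eq_mul, smul_eq_mul, map_mul,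
        Complex.conj_conj]
      ring

lemma isClosed_H2 : IsClosed (H2 : Set L2) := by
  have : (H2 : Set L2) = ⋂ n : ℤ, ⋂ _ : n < 0, {f : L2 | inner ℂ (fourierLp 2 n : L2) f = 0} := by
    ext f
    simp only [Set.mem_iInter, Set.mem_ofPred_eq, inner_fourierLp]
    rfl
  rw [this]
  exact isClosed_iInter fun n => isClosed_iInter fun _ =>
    isClosed_eq (continuous_const.inner continuous_id) continuous_const

lemma memLp_inner_mul {θ : L2} (hθ : IsInner θ) {f : UnitCircle → ℂ} (hf : MemLp f 2 circleMeasure) :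
    MemLp (fun t => θ t * f t) 2 circleMeasure := by
  refine hf.of_le ((Lp.aestronglyMeasurable θ).mul hf.1) ?_
  filter_upwards [hθ.2] with t ht
  rw [norm_mul, ht, one_mul]

/-- For an inner function `θ`, an element `f ∈ H²` is in `K_θ` iff it is orthogonal to `θ z ^ n` for
all `n ≥ 0`. It yields that `K_θ` is closed. -/
lemma mem_modelSpace_iff {θ : L2} (hθ : IsInner θ) (f : L2) :
    f ∈ modelSpace θ ↔ f ∈ H2 ∧ ∀ n : ℕ,
      inner ℂ ((memLp_inner_mul hθ (Lp.memLp (fourierLp 2 (n : ℤ) : L2))).toLp _ : L2) f = 0 := by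
  have key : ∀ (h : L2), (f =ᵐ[circleMeasure] fun t => θ t * conj (h t)) → ∀ n : ℕ,
      inner ℂ ((memLp_inner_mul hθ (Lp.memLp (fourierLp 2 (n : ℤ) : L2))).toLp _ : L2) f
        = conj (fourierCoeff h (-(n : ℤ))) := by
    intro h e n
    rw [← inner_fourierLp, L2.inner_def, L2.inner_def, ← integral_conj]
    refine integral_congr_ae ?_
    filter_upwards [e, hθ.2, MemLp.coeFn_toLp (memLp_inner_mul hθ
      (Lp.memLp (fourierLp 2 (n : ℤ) : L2))), coeFn_fourierLp (T := 2 * Real.pi) 2 (n : ℤ),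
      coeFn_fourierLp (T := 2 * Real.pi) 2 (-(n : ℤ))] with t a b c d d'
    have hb : conj (θ t) * θ t = 1 := by
      rw [Complex.conj_mul', b]; simp
    simp only [RCLike.inner_apply, c, d, d', a, map_mul, fourier_neg, Complex.conj_conj]
    linear_combination (conj (h t) * conj (fourier (n : ℤ) t)) * hb
  constructor
  · rintro ⟨hf, h, hh, h0, e⟩
    refine ⟨hf, fun n => ?_⟩
    rw [key h e n]
    rcases Nat.eq_zero_or_pos n with rfl | hn
    · simpa using h0
    · rw [hh _ (by omega), map_zero]
  · rintro ⟨hf, hn⟩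
    have hm : MemLp (fun t => θ t * conj (f t)) 2 circleMeasure :=
      memLp_inner_mul hθ (Lp.memLp f).star
    have e : f =ᵐ[circleMeasure] fun t => θ t * conj (hm.toLp _ t) := by
      filter_upwards [hθ.2, hm.coeFn_toLp] with t b c
      have hb : conj (θ t) * θ t = 1 := by
        rw [Complex.conj_mul', b]; simp
      rw [c, map_mul, Complex.conj_conj]
      linear_combination (-(f t)) * hb
    have hz : ∀ n : ℕ, fourierCoeff (hm.toLp _ : L2) (-(n : ℤ)) = 0 := fun n => by
      have := (key _ e n).symm.trans (hn n)
      simpa using this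
    refine ⟨hf, hm.toLp _, fun m hm0 => ?_, by simpa using hz 0, e⟩
    have := hz m.natAbs
    rwa [show (-(m.natAbs : ℤ)) = m by omega] at this

lemma isClosed_modelSpace {θ : L2} (hθ : IsInner θ) : IsClosed (modelSpace θ : Set L2) := by
  have : (modelSpace θ : Set L2) = (H2 : Set L2) ∩ ⋂ n : ℕ, {f : L2 |
      inner ℂ ((memLp_inner_mul hθ (Lp.memLp (fourierLp 2 (n : ℤ) : L2))).toLp _ : L2) f = 0} := by
    ext f
    simpa using mem_modelSpace_iff hθ f
  rw [this]
  exact isClosed_H2.inter (isClosed_iInter fun n =>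
    isClosed_eq (continuous_const.inner continuous_id) continuous_const)

lemma hasOrthogonalProjection_modelSpace {θ : L2} (hθ : IsInner θ) :
    (modelSpace θ).HasOrthogonalProjection :=
  haveI : CompleteSpace (modelSpace θ) := (isClosed_modelSpace hθ).completeSpace_coe
  inferInstance

/-- The orthogonal projection `P_θ : L² → K_θ`. -/
def modelProj {θ : L2} (hθ : IsInner θ) : L2 →L[ℂ] modelSpace θ :=
  haveI := hasOrthogonalProjection_modelSpace hθ
  (modelSpace θ).orthogonalProjectionOnto

lemma memLp_mul_add {g f₁ f₂ : L2} (h₁ : MemLp (fun t => g t * f₁ t) 2 circleMeasure)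
    (h₂ : MemLp (fun t => g t * f₂ t) 2 circleMeasure) :
    MemLp (fun t => g t * (f₁ + f₂ : L2) t) 2 circleMeasure := by
  refine (h₁.add h₂).ae_eq ?_
  filter_upwards [Lp.coeFn_add f₁ f₂] with t ht
  rw [ht, Pi.add_apply, Pi.add_apply, mul_add]

lemma memLp_mul_smul {g f : L2} (c : ℂ) (h : MemLp (fun t => g t * f t) 2 circleMeasure) :
    MemLp (fun t => g t * (c • f : L2) t) 2 circleMeasure := by
  refine (h.const_smul c).ae_eq ?_
  filter_upwards [Lp.coeFn_smul c f] with t ht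
  simp only [ht, Pi.smul_apply, smul_eq_mul]
  ring

/-- The truncated Toeplitz operator `A_g^θ f = P_θ (g f)` with symbol `g ∈ L²`, as a possibly
unbounded operator in `K_θ` with domain `{f ∈ K_θ : g f ∈ L²}`. Two such operators are equal iff they
have the same domain and agree on it. -/
def truncatedToeplitz {θ : L2} (hθ : IsInner θ) (g : L2) : modelSpace θ →ₗ.[ℂ] modelSpace θ where
  domain :=
    { carrier := {f | MemLp (fun t => g t * (f : L2) t) 2 circleMeasure}
      zero_mem' := by
        refine MemLp.zero.ae_eq (μ := circleMeasure) (f := fun _ => (0 : ℂ)) ?_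
        filter_upwards with t
        simp
      add_mem' := fun h₁ h₂ => memLp_mul_add h₁ h₂
      smul_mem' := fun c _ h => memLp_mul_smul c h }
  toFun :=
    { toFun := fun f => modelProj hθ (MemLp.toLp (fun t => g t * ((f : modelSpace θ) : L2) t) f.2)
      map_add' := fun f₁ f₂ => by
        rw [← map_add, ← MemLp.toLp_add]
        congr 1
        refine MemLp.toLp_congr _ _ ?_
        filter_upwards [Lp.coeFn_add ((f₁ : modelSpace θ) : L2) ((f₂ : modelSpace θ) : L2)] with t ht
        simp only [Submodule.coe_add, ht, Pi.add_apply, mul_add]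
      map_smul' := fun c f => by
        rw [RingHom.id_apply, ← map_smul, ← MemLp.toLp_const_smul]
        congr 1
        refine MemLp.toLp_congr _ _ ?_
        filter_upwards [Lp.coeFn_smul c ((f : modelSpace θ) : L2)] with t ht
        simp only [Submodule.coe_smul, ht, Pi.smul_apply, smul_eq_mul]
        ring }

end HardyTTO

end

open HardyTTO

/-! If `f = θ * conj h` lies in `K_θ`, then `conj (θ * u) * f = conj (u * h)`, which is orthogonal
to `H2` because `h(0) = 0`; the correction is thus invisible to `P_θ`. Since `|θ u| = 2|g| + 1`, the
new symbol has modulus between `|g| + 1` and `3|g| + 1`: the domain is unchanged and the inverse is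
bounded by 1 (`truncatedToeplitz_eq_of_symbol`).

The outer function comes from a Beurling-type argument (`exists_isOuter_norm_eq`) rather than from
the exponential of a Herglotz integral. With `W = 2|g| + 1`, let `F` be the component of `W`
orthogonal to the closed span of `z ^ n W`, `n ≥ 1`. Then `F` is orthogonal to its own positive
shifts, so `|F|` is constant, and `u = W * conj F / ‖F‖` is outer with `|u| = |W|`. -/

namespace HardyTTO

/-! ### Multiplication operators and the Hardy space -/

/-- The function `z ^ n` as an element of `L²(𝕋)`. -/
noncomputable abbrev monomialL2 (n : ℤ) : L2 := fourierLp 2 n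

/-- Multiplication by a bounded function, as a bounded operator on `L²(𝕋)`. -/
noncomputable def mulOp (φ : Lp ℂ ∞ circleMeasure) : L2 →L[ℂ] L2 :=
  (ContinuousLinearMap.mul ℂ ℂ).holderL circleMeasure ∞ 2 2 φ

lemma coeFn_mulOp (φ : Lp ℂ ∞ circleMeasure) (f : L2) :
    mulOp φ f =ᵐ[circleMeasure] fun t => φ t * f t :=
  (ContinuousLinearMap.mul ℂ ℂ).coeFn_holder φ f

/-- Multiplication by `z ^ n` on `L²(𝕋)`. -/
noncomputable def shiftOp (n : ℤ) : L2 →L[ℂ] L2 := mulOp (fourierLp ∞ n)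

lemma coeFn_shiftOp (n : ℤ) (f : L2) :
    shiftOp n f =ᵐ[circleMeasure] fun t => fourier n t * f t := by
  filter_upwards [coeFn_mulOp (fourierLp ∞ n) f,
    coeFn_fourierLp (T := 2 * Real.pi) ∞ n] with t a b
  rw [shiftOp, a, b]

lemma shiftOp_shiftOp (m n : ℤ) (f : L2) : shiftOp m (shiftOp n f) = shiftOp (m + n) f := by
  apply Lp.ext
  filter_upwards [coeFn_shiftOp m (shiftOp n f), coeFn_shiftOp n f, coeFn_shiftOp (m + n) f]
    with t a b c
  rw [a, b, c, fourier_add, mul_assoc]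

lemma shiftOp_zero (f : L2) : shiftOp 0 f = f := by
  apply Lp.ext
  filter_upwards [coeFn_shiftOp 0 f] with t a
  rw [a, fourier_zero, one_mul]

lemma inner_eq_integral (f g : L2) :
    inner ℂ f g = ∫ t, conj (f t) * g t ∂circleMeasure := by
  rw [L2.inner_def]
  refine integral_congr_ae (.of_forall fun t => ?_)
  simp [RCLike.inner_apply, mul_comm]

lemma inner_shiftOp_left (n : ℤ) (f g : L2) :
    inner ℂ (shiftOp n f) g = inner ℂ f (shiftOp (-n) g) := by
  rw [inner_eq_integral, inner_eq_integral]
  refine integral_congr_ae ?_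
  filter_upwards [coeFn_shiftOp n f, coeFn_shiftOp (-n) g] with t a b
  rw [a, b, map_mul, fourier_neg]
  ring

lemma shiftOp_monomialL2 (m n : ℤ) : shiftOp m (monomialL2 n) = monomialL2 (m + n) := by
  apply Lp.ext
  filter_upwards [coeFn_shiftOp m (monomialL2 n), coeFn_fourierLp (T := 2 * Real.pi) 2 n,
    coeFn_fourierLp (T := 2 * Real.pi) 2 (m + n)] with t a b c
  rw [a, b, c, fourier_add]

lemma shiftOp_mem_H2 (n : ℕ) {f : L2} (hf : f ∈ H2) : shiftOp n f ∈ H2 := by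
  intro m hm
  have h := inner_shiftOp_left (-n : ℤ) (monomialL2 m) f
  rw [neg_neg, shiftOp_monomialL2, inner_fourierLp] at h
  rw [← inner_fourierLp, ← h]
  exact hf _ (by omega)

/-- The analytic monomials span a dense subspace of `H²`: a closed subspace of `L²(𝕋)` that
contains all `z ^ n`, `n ≥ 0`, contains `H²`. -/
lemma H2_le_of_isClosed {V : Submodule ℂ L2} (hV : IsClosed (V : Set L2))
    (h : ∀ n : ℕ, monomialL2 n ∈ V) : H2 ≤ V := by
  intro f hf
  refine hV.mem_of_tendsto (hasSum_fourier_series_L2 f) (.of_forall fun s => ?_)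
  refine V.sum_mem fun n _ => ?_
  rcases lt_or_ge n 0 with hn | hn
  · rw [hf n hn, zero_smul]
    exact V.zero_mem
  · lift n to ℕ using hn
    exact V.smul_mem _ (h n)

lemma map_mem_of_mem_H2 {V : Submodule ℂ L2} (hV : IsClosed (V : Set L2)) (T : L2 →L[ℂ] L2)
    (h : ∀ n : ℕ, T (monomialL2 n) ∈ V) {f : L2} (hf : f ∈ H2) : T f ∈ V :=
  H2_le_of_isClosed (V := V.comap T.toLinearMap) (hV.preimage T.continuous) h hf

lemma inner_eq_zero_of_mem_H2 {x : L2} (hx : ∀ n : ℕ, inner ℂ (monomialL2 n) x = 0)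
    {f : L2} (hf : f ∈ H2) : inner ℂ f x = 0 := by
  have : H2 ≤ (ℂ ∙ x)ᗮ := H2_le_of_isClosed (Submodule.isClosed_orthogonal _) fun n =>
    Submodule.mem_orthogonal_singleton_iff_inner_left.2 (hx n)
  exact Submodule.mem_orthogonal_singleton_iff_inner_left.1 (this hf)

/-- If `u, h ∈ H²`, `h(0) = 0` and `u h ∈ L²`, then `\overline{u h}` is orthogonal to `H²`. -/
lemma inner_conj_mul_eq_zero {u h x v : L2} (hu : u ∈ H2) (hh : h ∈ H2)
    (h0 : fourierCoeff h 0 = 0) (hx : x =ᵐ[circleMeasure] fun t => conj (u t * h t))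
    (hv : v ∈ H2) : inner ℂ v x = 0 := by
  refine inner_eq_zero_of_mem_H2 (fun n => ?_) hv
  -- `conj h` has only strictly negative frequencies; `h0` is what covers `n = 0`.
  have hstar : ∀ n : ℕ, inner ℂ (monomialL2 n) (star h) = 0 := fun n => by
    have : inner ℂ (monomialL2 n) (star h) = conj (inner ℂ (monomialL2 (-n)) h) := by
      rw [inner_eq_integral, inner_eq_integral, ← integral_conj]
      refine integral_congr_ae ?_
      filter_upwards [Lp.coeFn_star h, coeFn_fourierLp (T := 2 * Real.pi) 2 (n : ℤ),
        coeFn_fourierLp (T := 2 * Real.pi) 2 (-(n : ℤ))] with t a b c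
      rw [a, b, c, Pi.star_apply, map_mul, fourier_neg, Complex.star_def]
      simp
    rw [this, inner_fourierLp]
    rcases Nat.eq_zero_or_pos n with rfl | hn
    · simpa using h0
    · rw [hh _ (by omega), map_zero]
  -- Moving `conj u` across turns the pairing of `z ^ n` with `x` into that of `z ^ n u` with `conj
  -- h`.
  rw [← inner_eq_zero_of_mem_H2 hstar (shiftOp_mem_H2 n hu), inner_eq_integral, inner_eq_integral]
  refine integral_congr_ae ?_
  filter_upwards [hx, Lp.coeFn_star h, coeFn_fourierLp (T := 2 * Real.pi) 2 (n : ℤ),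
    coeFn_shiftOp n u] with t a b c d
  rw [a, b, c, d, Pi.star_apply, Complex.star_def, map_mul, map_mul]
  ring

/-! ### Change of symbol -/

/-- Adding `\overline{θ u}`, `u ∈ H²`, to the symbol does not change the values of a truncated
Toeplitz operator. -/
lemma modelProj_conj_mul_eq_zero {θ u x : L2} (hθ : IsInner θ) (hu : u ∈ H2) {f : L2}
    (hf : f ∈ modelSpace θ) (hx : x =ᵐ[circleMeasure] fun t => conj (θ t * u t) * f t) :
    modelProj hθ x = 0 := by
  have := hasOrthogonalProjection_modelSpace hθ
  obtain ⟨-, h, hh, h0, e⟩ := hf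
  refine (Submodule.orthogonalProjectionOnto_eq_zero_iff).2 fun v hv => ?_
  refine inner_conj_mul_eq_zero hu hh h0 ?_ hv.1
  filter_upwards [hx, e, hθ.2] with t a b c
  have hb : conj (θ t) * θ t = 1 := by
    rw [Complex.conj_mul', c]; simp
  rw [a, b, map_mul, map_mul]
  linear_combination conj (u t) * conj (h t) * hb

/-- The factor 2 leaves a full `‖g‖` after the reverse triangle inequality, so the difference
dominates `g`; the 1 keeps it away from zero. -/
lemma norm_sub_bounds {g w : ℂ} (hw : ‖w‖ = 2 * ‖g‖ + 1) :
    ‖g‖ + 1 ≤ ‖g - w‖ ∧ ‖g - w‖ ≤ 3 * ‖g‖ + 1 := by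
  have h1 := norm_sub_norm_le w g
  have h2 := norm_sub_le g w
  rw [norm_sub_rev] at h1
  constructor <;> linarith

/-- Equality of domains: `|g' f| ≤ 3|g f| + |f|` with `f ∈ L²` one way, `|g f| ≤ |g' f|` the other.
-/
lemma memLp_mul_iff {g g' f : L2}
    (hg : ∀ᵐ t ∂circleMeasure, ‖g t‖ + 1 ≤ ‖g' t‖ ∧ ‖g' t‖ ≤ 3 * ‖g t‖ + 1) :
    MemLp (fun t => g t * f t) 2 circleMeasure ↔ MemLp (fun t => g' t * f t) 2 circleMeasure := by
  constructor
  · intro h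
    refine ((h.norm.const_mul 3).add (Lp.memLp f).norm).of_le
      ((Lp.aestronglyMeasurable g').mul (Lp.aestronglyMeasurable f)) ?_
    filter_upwards [hg] with t ht
    simp only [Pi.add_apply, norm_mul]
    rw [Real.norm_of_nonneg (by positivity)]
    nlinarith [mul_le_mul_of_nonneg_right ht.2 (norm_nonneg (f t))]
  · intro h
    refine h.of_le ((Lp.aestronglyMeasurable g).mul (Lp.aestronglyMeasurable f)) ?_
    filter_upwards [hg] with t ht
    rw [norm_mul, norm_mul]
    gcongr
    linarith

lemma truncatedToeplitz_eq_of_symbol {θ u g g' : L2} (hθ : IsInner θ) (hu : u ∈ H2)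
    (hug : ∀ᵐ t ∂circleMeasure, ‖u t‖ = 2 * ‖g t‖ + 1)
    (hg' : g' =ᵐ[circleMeasure] fun t => g t - conj (θ t * u t)) :
    truncatedToeplitz hθ g = truncatedToeplitz hθ g' := by
  have hb : ∀ᵐ t ∂circleMeasure, ‖g t‖ + 1 ≤ ‖g' t‖ ∧ ‖g' t‖ ≤ 3 * ‖g t‖ + 1 := by
    filter_upwards [hug, hg', hθ.2] with t a b c
    rw [b]
    exact norm_sub_bounds (by rw [RCLike.norm_conj, norm_mul, c, one_mul, a])
  refine LinearPMap.ext (Submodule.ext fun f => memLp_mul_iff hb) fun f hf hf' => ?_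
  change modelProj hθ (MemLp.toLp _ hf) = modelProj hθ (MemLp.toLp _ hf')
  rw [← sub_eq_zero, ← map_sub]
  refine modelProj_conj_mul_eq_zero hθ hu f.2 ?_
  filter_upwards [Lp.coeFn_sub (MemLp.toLp _ hf) (MemLp.toLp _ hf'), MemLp.coeFn_toLp hf,
    MemLp.coeFn_toLp hf', hg'] with t a b c d
  rw [a, Pi.sub_apply, b, c, d]
  ring

/-! ### Functions orthogonal to their positive shifts -/

/-- If `F ∈ L²(𝕋)` is orthogonal to `z ^ n F` for all `n ≥ 1`, then `|F|²` integrates every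
continuous function like a constant. -/
lemma integral_continuous_mul_norm_sq {F : L2}
    (hF : ∀ n : ℕ, inner ℂ (shiftOp (n + 1) F) F = 0) (φ : C(UnitCircle, ℂ)) :
    ∫ t, φ t * (‖F t‖ ^ 2 : ℝ) ∂circleMeasure = ‖F‖ ^ 2 * ∫ t, φ t ∂circleMeasure := by
  -- Both sides are continuous functionals of `φ`, so it suffices to compare them on the `fourier
  -- n`, whose span is dense.
  let T : C(UnitCircle, ℂ) →L[ℂ] ℂ :=
    (innerSL ℂ F).comp ((((ContinuousLinearMap.mul ℂ ℂ).holderL circleMeasure ∞ 2 2).flip F).comp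
      (ContinuousMap.toLp ∞ circleMeasure ℂ))
  let R : C(UnitCircle, ℂ) →L[ℂ] ℂ :=
    ((‖F‖ : ℂ) ^ 2) • (innerSL ℂ (monomialL2 0)).comp (ContinuousMap.toLp 2 circleMeasure ℂ)
  have hT (φ : C(UnitCircle, ℂ)) : T φ = ∫ t, φ t * (‖F t‖ ^ 2 : ℝ) ∂circleMeasure := by
    change inner ℂ F (mulOp (ContinuousMap.toLp ∞ circleMeasure ℂ φ) F) = _
    rw [inner_eq_integral]
    refine integral_congr_ae ?_
    filter_upwards [coeFn_mulOp (ContinuousMap.toLp ∞ circleMeasure ℂ φ) F,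
      ContinuousMap.coeFn_toLp (p := ∞) (𝕜 := ℂ) circleMeasure φ] with t a b
    rw [a, b]
    push_cast
    rw [← Complex.conj_mul']
    ring
  have hR (φ : C(UnitCircle, ℂ)) : R φ = ‖F‖ ^ 2 * ∫ t, φ t ∂circleMeasure := by
    change (‖F‖ : ℂ) ^ 2 * inner ℂ (monomialL2 0) (ContinuousMap.toLp 2 circleMeasure ℂ φ) = _
    rw [inner_eq_integral]
    congr 1
    refine integral_congr_ae ?_
    filter_upwards [coeFn_fourierLp (T := 2 * Real.pi) 2 0,
      ContinuousMap.coeFn_toLp (p := 2) (𝕜 := ℂ) circleMeasure φ] with t a b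
    rw [a, b]
    simp
  have hTn (n : ℤ) : T (fourier n) = inner ℂ F (shiftOp n F) := rfl
  have hRn (n : ℤ) : R (fourier n) = (‖F‖ : ℂ) ^ 2 * inner ℂ (monomialL2 0) (monomialL2 n) := rfl
  have key : (⊤ : Submodule ℂ C(UnitCircle, ℂ)) ≤ (T - R).ker := by
    rw [← span_fourier_closure_eq_top]
    refine Submodule.topologicalClosure_minimal _ (Submodule.span_le.2 ?_)
      (T - R).isClosed_ker
    rintro _ ⟨n, rfl⟩
    change T (fourier n) - R (fourier n) = 0
    rw [hTn, hRn, (orthonormal_iff_ite.1 (orthonormal_fourier (T := 2 * Real.pi))) 0 n]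
    rcases lt_trichotomy n 0 with hn | rfl | hn
    · rw [if_neg (by omega)]
      obtain ⟨k, rfl⟩ : ∃ k : ℕ, n = -((k : ℤ) + 1) := ⟨(-n - 1).toNat, by omega⟩
      rw [← inner_shiftOp_left, hF]
      simp
    · rw [shiftOp_zero, inner_self_eq_norm_sq_to_K]
      simp
    · rw [if_neg (by omega)]
      obtain ⟨k, rfl⟩ : ∃ k : ℕ, n = (k : ℤ) + 1 := ⟨(n - 1).toNat, by omega⟩
      rw [← inner_conj_symm, hF]
      simp
  have h : (T - R) φ = 0 := key Submodule.mem_top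
  rw [← hT, ← hR]
  exact sub_eq_zero.1 h

/-- If `F ∈ L²(𝕋)` is orthogonal to `z ^ n F` for all `n ≥ 1`, then `|F|` is constant. -/
lemma norm_ae_eq_of_inner_shiftOp {F : L2}
    (hF : ∀ n : ℕ, inner ℂ (shiftOp (n + 1) F) F = 0) :
    ∀ᵐ t ∂circleMeasure, ‖F t‖ = ‖F‖ := by
  have hmeas : Measurable fun t => ‖F t‖₊ ^ 2 :=
    ((Lp.stronglyMeasurable F).measurable.nnnorm).pow_const 2
  have hint : Integrable (fun t => ‖F t‖ ^ 2) circleMeasure :=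
    (Lp.memLp F).integrable_norm_pow (by norm_num)
  have : IsFiniteMeasure (circleMeasure.withDensity fun t => ((‖F t‖₊ ^ 2 : NNReal) : ℝ≥0∞)) := by
    refine isFiniteMeasure_withDensity ?_
    have := hint.hasFiniteIntegral
    rw [hasFiniteIntegral_iff_enorm] at this
    convert this.ne using 3 with t
    simp [enorm_eq_nnnorm]
  -- Finite measures with the same integrals of continuous functions coincide, hence so do their
  -- densities a.e.
  have h : circleMeasure.withDensity (fun t => ((‖F t‖₊ ^ 2 : NNReal) : ℝ≥0∞)) =
      circleMeasure.withDensity fun _ => ((‖F‖₊ ^ 2 : NNReal) : ℝ≥0∞) := by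
    have : IsFiniteMeasure
        (circleMeasure.withDensity fun _ => ((‖F‖₊ ^ 2 : NNReal) : ℝ≥0∞)) := by
      refine isFiniteMeasure_withDensity ?_
      rw [lintegral_const]
      simp
    refine ext_of_forall_integral_eq_of_IsFiniteMeasure fun f => ?_
    rw [integral_withDensity_eq_integral_smul hmeas,
      integral_withDensity_eq_integral_smul measurable_const]
    have := integral_continuous_mul_norm_sq hF ⟨fun t => (f t : ℂ), by fun_prop⟩
    simp only [ContinuousMap.coe_mk, integral_complex_ofReal, ← Complex.ofReal_mul,
      ← Complex.ofReal_pow, Complex.ofReal_inj] at this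
    simp only [NNReal.smul_def, NNReal.coe_pow, coe_nnnorm, smul_eq_mul, integral_const_mul,
      ← this]
    simp only [mul_comm]
  have h' := (withDensity_eq_iff_of_sigmaFinite hmeas.coe_nnreal_ennreal.aemeasurable
    aemeasurable_const).1 h
  filter_upwards [h'] with t ht
  have : ‖F t‖₊ ^ 2 = ‖F‖₊ ^ 2 := by exact_mod_cast ht
  exact congrArg NNReal.toReal ((pow_left_inj₀ (by positivity) (by positivity) two_ne_zero).1 this)

/-! ### Closed spans of shifts -/

/-- The closed subspace of `L²(𝕋)` spanned by `z ^ n W`, `n ≥ k`. -/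
noncomputable def shiftSpan (W : L2) (k : ℕ) : Submodule ℂ L2 :=
  (Submodule.span ℂ (Set.range fun n : ℕ => shiftOp (n + k) W)).topologicalClosure

lemma isClosed_shiftSpan (W : L2) (k : ℕ) : IsClosed (shiftSpan W k : Set L2) :=
  Submodule.isClosed_topologicalClosure _

lemma shiftOp_mem_shiftSpan (W : L2) (k n : ℕ) : shiftOp (n + k) W ∈ shiftSpan W k :=
  Submodule.le_topologicalClosure _ (Submodule.subset_span ⟨n, rfl⟩)

lemma shiftSpan_le {W : L2} {k : ℕ} {V : Submodule ℂ L2} (hV : IsClosed (V : Set L2))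
    (h : ∀ n : ℕ, shiftOp (n + k) W ∈ V) : shiftSpan W k ≤ V :=
  Submodule.topologicalClosure_minimal _
    (Submodule.span_le.2 (Set.range_subset_iff.2 h)) hV

lemma map_mem_of_mem_shiftSpan {W f : L2} {k : ℕ} {V : Submodule ℂ L2}
    (hV : IsClosed (V : Set L2)) (T : L2 →L[ℂ] L2) (h : ∀ n : ℕ, T (shiftOp (n + k) W) ∈ V)
    (hf : f ∈ shiftSpan W k) : T f ∈ V :=
  shiftSpan_le (V := V.comap T.toLinearMap) (hV.preimage T.continuous) h hf

lemma shiftOp_mem_shiftSpan_add {W f : L2} {k : ℕ} (j : ℕ) (hf : f ∈ shiftSpan W k) :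
    shiftOp j f ∈ shiftSpan W (k + j) := by
  refine map_mem_of_mem_shiftSpan (isClosed_shiftSpan _ _) (shiftOp j) (fun n => ?_) hf
  have h : (j : ℤ) + (n + k) = n + (k + j : ℕ) := by push_cast; ring
  rw [shiftOp_shiftOp, h]
  exact shiftOp_mem_shiftSpan W (k + j) n

lemma shiftSpan_anti (W : L2) {j k : ℕ} (h : j ≤ k) : shiftSpan W k ≤ shiftSpan W j :=
  shiftSpan_le (isClosed_shiftSpan _ _) fun n => by
    rw [show (n : ℤ) + k = (n + (k - j) : ℕ) + j by omega]
    exact shiftOp_mem_shiftSpan W j _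

/-- A function bounded away from `0` is not in the closed span of its strictly positive shifts. -/
lemma notMem_shiftSpan_one {W : L2} (hW : ∀ᵐ t ∂circleMeasure, 1 ≤ ‖W t‖) :
    W ∉ shiftSpan W 1 := by
  -- Separating vector: `1 / conj W` pairs with `z ^ n W` to `∫ z ^ n`, which is 0 for `n ≥ 1` and 1
  -- for `n = 0`.
  have hm : MemLp (fun t => conj (W t)⁻¹) 2 circleMeasure := by
    refine (memLp_const (1 : ℂ)).of_le ?_ ?_
    · exact (Complex.continuous_conj.measurable.comp
        (Lp.stronglyMeasurable W).measurable.inv).aestronglyMeasurable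
    · filter_upwards [hW] with t ht
      rw [RCLike.norm_conj, norm_inv, norm_one]
      exact inv_le_one_of_one_le₀ ht
  have key (n : ℕ) : inner ℂ (hm.toLp _ : L2) (shiftOp n W) =
      inner ℂ (monomialL2 0) (monomialL2 n) := by
    rw [inner_eq_integral, inner_eq_integral]
    refine integral_congr_ae ?_
    filter_upwards [hW, hm.coeFn_toLp, coeFn_shiftOp n W, coeFn_fourierLp (T := 2 * Real.pi) 2 0,
      coeFn_fourierLp (T := 2 * Real.pi) 2 n] with t a b c d e
    have : W t ≠ 0 := norm_pos_iff.1 (by linarith)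
    rw [b, c, d, e, Complex.conj_conj]
    simp only [fourier_zero, map_one, one_mul]
    field_simp
  have horth := orthonormal_iff_ite.1 (orthonormal_fourier (T := 2 * Real.pi)) 0
  intro hmem
  have hle : shiftSpan W 1 ≤ (ℂ ∙ (hm.toLp _ : L2))ᗮ :=
    shiftSpan_le (Submodule.isClosed_orthogonal _) fun n => by
      rw [Submodule.mem_orthogonal_singleton_iff_inner_right]
      have := key (n + 1)
      rw [horth, if_neg (by omega)] at this
      exact_mod_cast this
  have h1 := Submodule.mem_orthogonal_singleton_iff_inner_right.1 (hle hmem)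
  have h2 := key 0
  rw [horth, Nat.cast_zero, shiftOp_zero, h1, if_pos rfl] at h2
  exact zero_ne_one h2

/-! ### Construction of the outer function -/

/-- **Existence of outer functions with prescribed modulus** bounded away from `0`. -/
theorem exists_isOuter_norm_eq {W : L2} (hW : ∀ᵐ t ∂circleMeasure, 1 ≤ ‖W t‖) :
    ∃ u : L2, IsOuter u ∧ ∀ᵐ t ∂circleMeasure, ‖u t‖ = ‖W t‖ := by
  have : CompleteSpace (shiftSpan W 1) := (isClosed_shiftSpan W 1).completeSpace_coe
  obtain ⟨F, hF⟩ : ∃ F : L2, F = W - (shiftSpan W 1).starProjection W := ⟨_, rfl⟩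
  have hWmem : W ∈ shiftSpan W 0 := by
    simpa [shiftOp_zero] using shiftOp_mem_shiftSpan W 0 0
  have hForth (f : L2) (hf : f ∈ shiftSpan W 1) : inner ℂ f F = 0 := by
    rw [hF]
    exact (Submodule.mem_orthogonal _ _).1
      ((shiftSpan W 1).sub_starProjection_mem_orthogonal W) f hf
  have hFmem : F ∈ shiftSpan W 0 := by
    rw [hF]
    exact Submodule.sub_mem _ hWmem (shiftSpan_anti W zero_le_one
      ((shiftSpan W 1).starProjection_apply_mem W))
  have hF0 : ‖F‖ ≠ 0 := by
    rw [norm_ne_zero_iff, hF, sub_ne_zero]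
    intro h
    have hmem := (shiftSpan W 1).starProjection_apply_mem W
    rw [← h] at hmem
    exact notMem_shiftSpan_one hW hmem
  -- As `F` lies in `shiftSpan W 0`, its positive shifts lie in `shiftSpan W 1`, to which `F` is
  -- orthogonal.
  have hFnorm : ∀ᵐ t ∂circleMeasure, ‖F t‖ = ‖F‖ := norm_ae_eq_of_inner_shiftOp fun n =>
    hForth _ (shiftSpan_anti W (j := 1) (k := 0 + (n + 1)) (by omega)
      (by exact_mod_cast shiftOp_mem_shiftSpan_add (n + 1) hFmem))
  have hFtop : MemLp F ∞ circleMeasure :=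
    memLp_top_of_bound (Lp.aestronglyMeasurable F) ‖F‖ (hFnorm.mono fun t ht => ht.le)
  have hum : MemLp (fun t => (‖F‖ : ℂ)⁻¹ * (W t * conj (F t))) 2 circleMeasure := by
    refine (Lp.memLp W).of_le (((Lp.aestronglyMeasurable W).mul
      (Lp.aestronglyMeasurable F).star).const_mul _) ?_
    filter_upwards [hFnorm] with t ht
    simp only [norm_mul, norm_inv, RCLike.norm_conj, ht, Complex.norm_real, norm_norm]
    field_simp
    rfl
  obtain ⟨u, hu⟩ : ∃ u : L2, u =ᵐ[circleMeasure] fun t => (‖F‖ : ℂ)⁻¹ * (W t * conj (F t)) :=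
    ⟨hum.toLp _, hum.coeFn_toLp⟩
  -- The coefficient of `u` at `-(k + 1)` is, up to a factor and conjugation, the pairing of `z ^ (k
  -- + 1) W` with `F`.
  have huH : u ∈ H2 := by
    intro n hn
    obtain ⟨k, rfl⟩ : ∃ k : ℕ, n = -((k : ℤ) + 1) := ⟨(-n - 1).toNat, by omega⟩
    have h : inner ℂ (monomialL2 (-((k : ℤ) + 1))) u
        = (‖F‖ : ℂ)⁻¹ * conj (inner ℂ (shiftOp (k + 1) W) F) := by
      rw [inner_eq_integral, inner_eq_integral, ← integral_conj, ← integral_const_mul]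
      refine integral_congr_ae ?_
      filter_upwards [hu, coeFn_shiftOp (k + 1) W,
        coeFn_fourierLp (T := 2 * Real.pi) 2 (-((k : ℤ) + 1))] with t a b c
      rw [a, b, c, fourier_neg]
      simp only [map_mul, Complex.conj_conj]
      ring
    rw [← inner_fourierLp, h, hForth _ (by exact_mod_cast shiftOp_mem_shiftSpan W 1 k)]
    simp
  -- `F f` lies in `shiftSpan W 0` because `f` is analytic, and is orthogonal to it because `f` is
  -- orthogonal to every `z ^ n u`. So `F f = 0`, and `F` vanishes almost nowhere.
  have hcyclic (f : L2) (hf : f ∈ H2) (horth : ∀ n : ℕ, inner ℂ (shiftOp n u) f = 0) : f = 0 := by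
    have hmem : mulOp (hFtop.toLp F) f ∈ shiftSpan W 0 := by
      refine map_mem_of_mem_H2 (isClosed_shiftSpan W 0) (mulOp (hFtop.toLp F)) (fun n => ?_) hf
      have : mulOp (hFtop.toLp F) (monomialL2 n) = shiftOp n F := by
        apply Lp.ext
        filter_upwards [coeFn_mulOp (hFtop.toLp F) (monomialL2 n), hFtop.coeFn_toLp,
          coeFn_fourierLp (T := 2 * Real.pi) 2 n, coeFn_shiftOp n F] with t a b c d
        rw [a, b, c, d, mul_comm]
      rw [this]
      exact shiftSpan_anti W (Nat.zero_le _) (shiftOp_mem_shiftSpan_add n hFmem)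
    have hperp : shiftSpan W 0 ≤ (ℂ ∙ mulOp (hFtop.toLp F) f)ᗮ :=
      shiftSpan_le (Submodule.isClosed_orthogonal _) fun n => by
        rw [Submodule.mem_orthogonal_singleton_iff_inner_left]
        have h : inner ℂ (shiftOp n W) (mulOp (hFtop.toLp F) f)
            = ‖F‖ * inner ℂ (shiftOp n u) f := by
          rw [inner_eq_integral, inner_eq_integral, ← integral_const_mul]
          refine integral_congr_ae ?_
          filter_upwards [coeFn_shiftOp n W, coeFn_shiftOp n u, hu, hFtop.coeFn_toLp,
            coeFn_mulOp (hFtop.toLp F) f] with t a b c d e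
          have : (‖F‖ : ℂ) ≠ 0 := by exact_mod_cast hF0
          rw [a, b, c, e, d]
          simp only [map_mul, map_inv₀, Complex.conj_ofReal, Complex.conj_conj]
          field_simp
        simp only [Nat.cast_zero, add_zero]
        rw [h, horth n, mul_zero]
    have h0 : mulOp (hFtop.toLp F) f = 0 := inner_self_eq_zero.1
      (Submodule.mem_orthogonal_singleton_iff_inner_left.1 (hperp hmem))
    apply Lp.ext
    filter_upwards [coeFn_mulOp (hFtop.toLp F) f, hFtop.coeFn_toLp, hFnorm,
      Lp.coeFn_zero ℂ 2 circleMeasure, (Lp.ext_iff.1 h0)] with t a b c d e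
    rw [d] at e ⊢
    have : F t ≠ 0 := norm_ne_zero_iff.1 (by rwa [c])
    rw [a, b] at e
    exact (mul_eq_zero.1 e).resolve_left this
  refine ⟨u, ⟨huH, ?_⟩, ?_⟩
  · set V := Submodule.span ℂ {f : L2 | ∃ n : ℕ, f =ᵐ[circleMeasure]
      fun t => fourier (n : ℤ) t * u t}
    have hVmem (n : ℕ) : shiftOp n u ∈ V.topologicalClosure :=
      V.le_topologicalClosure (Submodule.subset_span ⟨n, coeFn_shiftOp n u⟩)
    have hle : V.topologicalClosure ≤ H2 := by
      refine Submodule.topologicalClosure_minimal _ (Submodule.span_le.2 ?_) isClosed_H2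
      rintro f ⟨n, hn⟩
      rw [show f = shiftOp n u from Lp.ext (hn.trans (coeFn_shiftOp n u).symm)]
      exact shiftOp_mem_H2 n huH
    refine le_antisymm hle fun f hf => ?_
    have : CompleteSpace V.topologicalClosure :=
      V.isClosed_topologicalClosure.completeSpace_coe
    have hp := V.topologicalClosure.starProjection_apply_mem f
    have := hcyclic (f - V.topologicalClosure.starProjection f) (H2.sub_mem hf (hle hp)) fun n =>
      (Submodule.mem_orthogonal _ _).1
        (V.topologicalClosure.sub_starProjection_mem_orthogonal f) _ (hVmem n)
    rw [sub_eq_zero.1 this]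
    exact hp
  · filter_upwards [hu, hFnorm] with t a b
    rw [a]
    simp only [norm_mul, norm_inv, RCLike.norm_conj, b, Complex.norm_real, norm_norm]
    field_simp

end HardyTTO

open HardyTTO

theorem mainTheorem11 (θ : L2) (hθ : IsInner θ) (g : L2) :
    (∃ u : L2, IsOuter u ∧ ∀ᵐ t ∂circleMeasure, ‖u t‖ = 2 * ‖g t‖ + 1) ∧
    ∀ u : L2, IsOuter u → (∀ᵐ t ∂circleMeasure, ‖u t‖ = 2 * ‖g t‖ + 1) →
      ∃ g' : L2,
        (g' =ᵐ[circleMeasure] fun t => g t - conj (θ t * u t)) ∧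
        truncatedToeplitz hθ g = truncatedToeplitz hθ g' ∧
        (∀ᵐ t ∂circleMeasure, g' t ≠ 0) ∧
        MemLp (fun t => (g' t)⁻¹) ∞ circleMeasure := by
  constructor
  · have hm : MemLp (fun t => ((2 * ‖g t‖ + 1 : ℝ) : ℂ)) 2 circleMeasure :=
      (((Lp.memLp g).norm.const_mul 2).add (memLp_const 1)).ofReal
    have hn : ∀ᵐ t ∂circleMeasure, ‖hm.toLp _ t‖ = 2 * ‖g t‖ + 1 := by
      filter_upwards [hm.coeFn_toLp] with t ht
      rw [ht, Complex.norm_real, Real.norm_of_nonneg (by positivity)]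
    obtain ⟨u, hu, hun⟩ := exists_isOuter_norm_eq (W := hm.toLp _) (by
      filter_upwards [hn] with t ht
      rw [ht]
      linarith [norm_nonneg (g t)])
    exact ⟨u, hu, by filter_upwards [hun, hn] with t a b using a.trans b⟩
  · intro u hu hun
    have hm : MemLp (fun t => g t - conj (θ t * u t)) 2 circleMeasure :=
      (Lp.memLp g).sub (memLp_inner_mul hθ (Lp.memLp u)).star
    have hb : ∀ᵐ t ∂circleMeasure, 1 ≤ ‖hm.toLp _ t‖ := by
      filter_upwards [hm.coeFn_toLp, hun, hθ.2] with t a b c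
      rw [a]
      have := (norm_sub_bounds (g := g t) (w := conj (θ t * u t))
        (by rw [RCLike.norm_conj, norm_mul, c, one_mul, b])).1
      linarith [norm_nonneg (g t)]
    refine ⟨hm.toLp _, hm.coeFn_toLp, truncatedToeplitz_eq_of_symbol hθ hu.1 hun hm.coeFn_toLp,
      hb.mono fun t ht => norm_pos_iff.1 (by linarith), memLp_top_of_bound
        (Lp.stronglyMeasurable _).measurable.inv.aestronglyMeasurable 1 ?_⟩
    filter_upwards [hb] with t ht
    rw [norm_inv]
    exact inv_le_one_of_one_le₀ ht
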